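/- **Theorem (the $(k+1)$-Slope Theorem).** Let $k\ge 1$ and $f\in\mathbb R^k$. Call $s\colon\mathbb R^k\to\mathbb Z_{\ge 0}$ *feasible* if it has finite support and $f+\sum_{r\in\mathbb R^k} r\,s_r\in\mathbb Z^k$ (the infinite group relaxation given by $f$). A function $\pi\colon\mathbb R^k\to\mathbb R$ is *valid* if $\pi\ge 0$ and $\sum_{r}\pi(r)s_r\ge 1$ for every feasible $s$. A valid function $\pi$ is *minimal* if there is no valid $\pi'\ne\pi$ with $\pi'\le\pi$ pointwise; it is *extreme* if $\pi=\tfrac12\pi_1+\tfrac12\pi_2$ with $\pi_1,\pi_2$ valid implies $\pi=\pi_1=\pi_2$; and it is a *facet* if, for every valid $\pi'$, $S(\pi)\subseteq S(\pi')$ implies $\pi'=\pi$, where $S(\pi)$ is the set of feasible $s$ with $\sum_r\pi(r)s_r=1$. A *polyhedral complex* in $\mathbb R^k$ is a collection $\mathcal P$ of polyhedra that contains every face (including the empty face) of each of its members and in which the intersection of any two members is a face of both. A *maximal cell* is a member not contained in any other member; $\mathcal P$ is *pure* if all its maximal cells have the same dimension and *complete* if its members cover $\mathbb R^k$. A *polyhedral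 fan* is a finite polyhedral complex whose nonempty members are cones with apex $0$. The complex $\mathcal P$ is *locally finite* if for every $r\in\mathbb R^k$ there are an open ball $B$ centred at $r$ and a polyhedral fan $\mathcal F$ such that $\{P\cap B : P\in\mathcal P\}$ and $\{(C+r)\cap B : C\in\mathcal F\}$ have the same nonempty members. A function $\pi\colon\mathbb R^k\to\mathbb R$ is *piecewise linear with cell complex $\mathcal P$* if $\mathcal P$ is a pure, complete polyhedral complex and for every maximal cell $P$ there are $g^P\in\mathbb R^k$ and $\delta_P\in\mathbb R$ with $\pi(r)=g^P\cdot r+\delta_P$ for all $r\in P$; it *has $n$ slopes* if exactly $n$ different vectors occur as gradients $g^P$ of maximal cells $P$. It is *genuinely $k$-dimensional* if there are no function $\varphi\colon\mathbb R^{k-1}\to\mathbb R$ and linear map $T\colon\mathbb R^k\to\mathbb R^{k-1}$ with $\pi=\varphi\circ T$. Let $\pi\colon\mathbb R^k\to\mathbb R$ be a minimal valid function that is piecewise linear with a locally finite cell complex $\mathcal P$, is genuinely $k$-dimensional, and has at most $k+1$ slopes. Then $\pi$ is a facet, $\pi$ is extreme, and $\pi$ has exactly $k+1$ slopes. -/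

import Mathlib

namespace GroupRelaxation

/-- The space `ℝ^k` with its Euclidean norm and dot product. -/
abbrev E (k : ℕ) : Type := EuclideanSpace ℝ (Fin k)

section Polyhedra

variable {k : ℕ}

/-- A polyhedron: the intersection of finitely many closed half-spaces. The empty set and the whole
space are polyhedra. -/
def IsPolyhedron (P : Set (E k)) : Prop :=
  ∃ (n : ℕ) (a : Fin n → E k) (b : Fin n → ℝ), P = {x | ∀ i, inner ℝ (a i) x ≤ b i}

/-- `F` is a face of `P`: it is empty, or it is the set of maximizers over `P` of a linear
functional. In particular `∅` and `P` itself are faces of `P`. -/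
def IsFaceOf (F P : Set (E k)) : Prop := IsExposed ℝ P F

/-- A polyhedral complex: a collection of polyhedra that contains all faces of its members, and in
which any two members intersect in a common face. -/
structure IsPolyhedralComplex (𝒞 : Set (Set (E k))) : Prop where
  polyhedron : ∀ P ∈ 𝒞, IsPolyhedron P
  face_mem : ∀ P ∈ 𝒞, ∀ F, IsFaceOf F P → F ∈ 𝒞
  inter_left : ∀ P ∈ 𝒞, ∀ Q ∈ 𝒞, IsFaceOf (P ∩ Q) P
  inter_right : ∀ P ∈ 𝒞, ∀ Q ∈ 𝒞, IsFaceOf (P ∩ Q) Q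

/-- A maximal cell of `𝒞`: a member that is not contained in any other member. -/
def IsMaximalCell (𝒞 : Set (Set (E k))) (P : Set (E k)) : Prop :=
  P ∈ 𝒞 ∧ ∀ Q ∈ 𝒞, P ⊆ Q → Q = P

/-- The dimension of (the affine hull of) a set. -/
noncomputable def cellDim (P : Set (E k)) : ℕ := Module.finrank ℝ (vectorSpan ℝ P)

/-- All maximal cells have the same dimension. -/
def IsPure (𝒞 : Set (Set (E k))) : Prop :=
  ∀ P Q, IsMaximalCell 𝒞 P → IsMaximalCell 𝒞 Q → cellDim P = cellDim Q

/-- The members of `𝒞` cover the whole space. -/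
def IsCompleteComplex (𝒞 : Set (Set (E k))) : Prop := ⋃₀ 𝒞 = Set.univ

/-- A cone with apex at the origin (used below for polyhedra, which are convex anyway). -/
def IsConeAtOrigin (C : Set (E k)) : Prop :=
  (0 : E k) ∈ C ∧ ∀ x ∈ C, ∀ t : ℝ, 0 ≤ t → t • x ∈ C

/-- A polyhedral fan: a finite polyhedral complex of cones. The empty face, which every nonempty
complex contains, is exempt from being a cone. -/
structure IsPolyhedralFan (ℱ : Set (Set (E k))) : Prop where
  complex : IsPolyhedralComplex ℱ
  finite : ℱ.Finite
  cone : ∀ C ∈ ℱ, C.Nonempty → IsConeAtOrigin C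

/-- The restriction `𝒞 ∩ X = {P ∩ X | P ∈ 𝒞, P ∩ X ≠ ∅}`. -/
def restrictCells (𝒞 : Set (Set (E k))) (X : Set (E k)) : Set (Set (E k)) :=
  {Y | Y.Nonempty ∧ ∃ P ∈ 𝒞, Y = P ∩ X}

/-- The translate `ℱ + r = {C + r | C ∈ ℱ}`. -/
def translateCells (ℱ : Set (Set (E k))) (r : E k) : Set (Set (E k)) :=
  (fun C : Set (E k) => (fun x => x + r) '' C) '' ℱ

/-- Around every point `r` the complex coincides, within an open ball, with the translate to `r` of
a polyhedral fan. -/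
def IsLocallyFiniteComplex (𝒞 : Set (Set (E k))) : Prop :=
  ∀ r : E k, ∃ ε : ℝ, 0 < ε ∧ ∃ ℱ : Set (Set (E k)), IsPolyhedralFan ℱ ∧
    restrictCells 𝒞 (Metric.ball r ε) = restrictCells (translateCells ℱ r) (Metric.ball r ε)

end Polyhedra

section PiecewiseLinear

variable {k : ℕ}

/-- `θ` is affine on `P` with gradient `g`: `θ r = g · r + δ` for all `r ∈ P`, for some `δ`. -/
def HasGradientOn (θ : E k → ℝ) (P : Set (E k)) (g : E k) : Prop :=
  ∃ δ : ℝ, ∀ r ∈ P, θ r = inner ℝ g r + δ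

/-- `θ` is piecewise linear with cell complex `𝒞`: `𝒞` is a pure, complete polyhedral complex and
`θ` is affine on each maximal cell. (That cells of one class of some partition of the maximal cells
share a gradient is no further condition, as the partition into singletons is allowed.) -/
structure IsPiecewiseLinear (θ : E k → ℝ) (𝒞 : Set (Set (E k))) : Prop where
  complex : IsPolyhedralComplex 𝒞
  pure : IsPure 𝒞
  complete : IsCompleteComplex 𝒞
  affine : ∀ P, IsMaximalCell 𝒞 P → ∃ g, HasGradientOn θ P g

/-- The gradient set of `θ` with respect to `𝒞`: the gradients of `θ` on the maximal cells. (When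
`𝒞` is pure, complete and locally finite, its maximal cells are full-dimensional, so each of them
contributes exactly one gradient.) -/
def gradientSet (θ : E k → ℝ) (𝒞 : Set (Set (E k))) : Set (E k) :=
  {g | ∃ P, IsMaximalCell 𝒞 P ∧ HasGradientOn θ P g}

/-- `θ` has `n` slopes: there are exactly `n` (in particular, finitely many) gradients. -/
def HasSlopes (θ : E k → ℝ) (𝒞 : Set (Set (E k))) (n : ℕ) : Prop :=
  (gradientSet θ 𝒞).encard = n

/-- `θ` does not factor through a linear map `ℝ^k → ℝ^(k-1)`. -/
def GenuinelyKDimensional (θ : E k → ℝ) : Prop :=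
  ¬ ∃ (φ : E (k - 1) → ℝ) (T : E k →ₗ[ℝ] E (k - 1)), θ = φ ∘ T

end PiecewiseLinear

section Relaxation

variable {k : ℕ}

/-- `s` is a feasible solution of the infinite group relaxation: `s : ℝ^k → ℤ₊` has finite support
and `f + ∑ r, s_r r ∈ ℤ^k`. -/
def IsFeasible (f : E k) (s : E k →₀ ℕ) : Prop :=
  ∃ z : Fin k → ℤ, ∀ i, (f + s.sum fun r n => (n : ℝ) • r) i = (z i : ℝ)

/-- The finite sum `∑ r, π(r) s_r`. -/
noncomputable def pairing (π : E k → ℝ) (s : E k →₀ ℕ) : ℝ := s.sum fun r n => π r * (n : ℝ)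

/-- Valid functions: nonnegative, with `∑ r, π(r) s_r ≥ 1` for every feasible `s`. -/
def IsValid (f : E k) (π : E k → ℝ) : Prop :=
  (∀ r, 0 ≤ π r) ∧ ∀ s, IsFeasible f s → 1 ≤ pairing π s

/-- Minimal valid functions: no other valid function is pointwise at most `π`. -/
def IsMinimalValid (f : E k) (π : E k → ℝ) : Prop :=
  IsValid f π ∧ ¬ ∃ π' : E k → ℝ, IsValid f π' ∧ π' ≠ π ∧ ∀ r, π' r ≤ π r

/-- Extreme functions: valid functions that are not the midpoint of two other valid functions. -/
def IsExtremeFunction (f : E k) (π : E k → ℝ) : Prop :=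
  IsValid f π ∧ ∀ π₁ π₂ : E k → ℝ, IsValid f π₁ → IsValid f π₂ →
    (∀ r, π r = 1 / 2 * π₁ r + 1 / 2 * π₂ r) → π = π₁ ∧ π = π₂

/-- `S(π)`: the feasible solutions at which the inequality given by `π` is tight. -/
def tightSolutions (f : E k) (π : E k → ℝ) : Set (E k →₀ ℕ) :=
  {s | IsFeasible f s ∧ pairing π s = 1}

/-- Facets: valid functions `π` such that `S(π) ⊆ S(π')` with `π'` valid forces `π' = π`. -/
def IsFacet (f : E k) (π : E k → ℝ) : Prop :=
  IsValid f π ∧ ∀ π' : E k → ℝ, IsValid f π' →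
    tightSolutions f π ⊆ tightSolutions f π' → π' = π

end Relaxation

end GroupRelaxation

/-!
A minimal valid `π` vanishes on `ℤ^k` and is subadditive, periodic and symmetric,
`π r + π (-f - r) = 1`. Symmetry makes each relation `π (u + v) = π u + π v` visible in a tight
solution, so a valid `θ` with `S(π) ⊆ S(θ)` is additive wherever `π` is; it is also subadditive,
vanishes on `ℤ^k`, and `θ (-f) = 1`. It has to be shown that `θ = π`; extremeness follows at once.

*Near the origin.* Subadditivity makes `π` there the maximum of the linear functions `⟨g, ·⟩`, for `g`
a gradient of a cell through the origin (`HasCells.exists_eq_max`). This maximum is positive off the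
origin: a zero would spread along a ray by subadditivity and along the whole line by recurrence in
the torus, and then `π` would factor through a quotient by this line
(`not_genuinelyKDimensional_of_segment`). Hence these gradients affinely span `ℝ^k`, so there are at
least `k + 1` of them; so they are all the gradients, and they are affinely independent
(`IsMinimalValid.exists_eq_max_gradients`).

*Rigidity.* The cones where one `⟨gᵢ, ·⟩` is maximal are then simplicial and have only `k + 1` rays
in total. On each cone `θ` is additive and nonnegative near the origin, so it is linear there by
Cauchy's equation, and it is determined by its `k + 1` slopes along the rays. The functions
`⟨h, ·⟩ + c π` already realize all choices of slopes, so `θ` is of this form near the origin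
(`exists_eq_inner_add_mul`).

*Globalization.* Within a cell with gradient `gᵢ`, both `π` and `θ` are additive along small steps
in the `i`-th cone. So the difference between `θ` and `⟨h, ·⟩ + c π` is constant on every cell, and
being continuous it is zero (`HasCells.eq_of_invariant`). Evaluation at the unit vectors, where
`π` and `θ` vanish, gives `h = 0`, and evaluation at `-f` gives `c = 1`.
-/

namespace GroupRelaxation

variable {k : ℕ}

/-! ### Minimal valid functions -/

/-- The lattice `ℤ^k` inside `ℝ^k`. -/
def intLattice (k : ℕ) : AddSubgroup (E k) where
  carrier := {r | ∃ z : Fin k → ℤ, ∀ i, r i = (z i : ℝ)}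
  zero_mem' := ⟨0, by simp⟩
  add_mem' := by
    rintro a b ⟨z, hz⟩ ⟨w, hw⟩
    exact ⟨z + w, fun i => by simp [hz, hw]⟩
  neg_mem' := by
    rintro a ⟨z, hz⟩
    exact ⟨-z, fun i => by simp [hz]⟩

/-- The point `∑ r, s_r r` that a finitely supported `s` represents. -/
noncomputable def total (s : E k →₀ ℕ) : E k := s.sum fun r n => (n : ℝ) • r

lemma isFeasible_iff {f : E k} {s : E k →₀ ℕ} : IsFeasible f s ↔ f + total s ∈ intLattice k :=
  Iff.rfl

lemma total_add (s t : E k →₀ ℕ) : total (s + t) = total s + total t :=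
  Finsupp.sum_add_index' (by simp) (by intros; push_cast; rw [add_smul])

lemma total_single (r : E k) (n : ℕ) : total (Finsupp.single r n) = (n : ℝ) • r :=
  Finsupp.sum_single_index (by simp)

lemma total_zero : total (0 : E k →₀ ℕ) = 0 := Finsupp.sum_zero_index

lemma pairing_add (π : E k → ℝ) (s t : E k →₀ ℕ) :
    pairing π (s + t) = pairing π s + pairing π t :=
  Finsupp.sum_add_index' (by simp) (by intros; push_cast; ring)

lemma pairing_single (π : E k → ℝ) (r : E k) (n : ℕ) :
    pairing π (Finsupp.single r n) = π r * n :=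
  Finsupp.sum_single_index (by simp)

lemma pairing_zero (π : E k → ℝ) : pairing π 0 = 0 := Finsupp.sum_zero_index

/-- A property of finitely supported functions that holds for `0` and for each unit vector, and is
stable under addition, holds always. -/
lemma induction_unit {p : (E k →₀ ℕ) → Prop} (s : E k →₀ ℕ) (h0 : p 0)
    (hadd : ∀ s t, p s → p t → p (s + t)) (h1 : ∀ r, p (Finsupp.single r 1)) : p s := by
  refine Finsupp.induction_linear s h0 hadd fun r n => ?_
  induction n with
  | zero => simpa using h0
  | succ n ih => rw [Finsupp.single_add]; exact hadd _ _ ih (h1 r)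

/-- If every `r` can be replaced, modulo `ℤ^k`, by a finite combination that costs at most `π' r`
under the valid function `π`, then `π'` is valid. -/
lemma IsValid.of_substitution {f : E k} {π π' : E k → ℝ} (hπ : IsValid f π)
    (hnn : ∀ r, 0 ≤ π' r)
    (hsubst : ∀ r, ∃ t : E k →₀ ℕ, total t - r ∈ intLattice k ∧ pairing π t ≤ π' r) :
    IsValid f π' := by
  refine ⟨hnn, fun s hs => ?_⟩
  have key : ∃ t : E k →₀ ℕ, total t - total s ∈ intLattice k ∧
      pairing π t ≤ pairing π' s := by
    refine induction_unit (p := fun s => ∃ t : E k →₀ ℕ, total t - total s ∈ intLattice k ∧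
      pairing π t ≤ pairing π' s) s ⟨0, by simp [total_zero, zero_mem], by simp [pairing_zero]⟩ ?_ ?_
    · rintro s t ⟨s', hs, hs'⟩ ⟨t', ht, ht'⟩
      refine ⟨s' + t', ?_, ?_⟩
      · rw [total_add, total_add, add_sub_add_comm]
        exact add_mem hs ht
      · rw [pairing_add, pairing_add]
        exact add_le_add hs' ht'
    · intro r
      simpa [total_single, pairing_single] using hsubst r
  obtain ⟨t, ht, hle⟩ := key
  refine (hπ.2 t ?_).trans hle
  rw [isFeasible_iff] at hs ⊢
  convert add_mem hs ht using 1
  abel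

lemma IsMinimalValid.eq_of_le {f : E k} {π π' : E k → ℝ} (hπ : IsMinimalValid f π)
    (hπ' : IsValid f π') (hle : ∀ r, π' r ≤ π r) : π' = π := by
  by_contra hne
  exact hπ.2 ⟨π', hπ', hne, hle⟩

lemma IsMinimalValid.eq_zero_of_mem {f : E k} {π : E k → ℝ} (hπ : IsMinimalValid f π)
    {z : E k} (hz : z ∈ intLattice k) : π z = 0 := by
  classical
  have hnn := hπ.1.1
  have hval : IsValid f (Function.update π z 0) := by
    refine hπ.1.of_substitution (fun r => ?_) fun r => ?_
    · rcases eq_or_ne r z with rfl | h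
      · simp
      · simpa [h] using hnn r
    · rcases eq_or_ne r z with rfl | h
      · exact ⟨0, by simpa [total_zero] using hz, by simp [pairing_zero]⟩
      · exact ⟨Finsupp.single r 1, by simp [total_single, zero_mem],
          by simp [pairing_single, h]⟩
  have := hπ.eq_of_le hval fun r => by
    rcases eq_or_ne r z with rfl | h
    · simpa using hnn r
    · simp [h]
  rw [← this]
  simp

lemma IsMinimalValid.subadditive {f : E k} {π : E k → ℝ} (hπ : IsMinimalValid f π) (u v : E k) :
    π (u + v) ≤ π u + π v := by
  classical
  have hnn := hπ.1.1
  by_contra! hlt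
  have hval : IsValid f (Function.update π (u + v) (π u + π v)) := by
    refine hπ.1.of_substitution (fun r => ?_) fun r => ?_
    · rcases eq_or_ne r (u + v) with rfl | h
      · simpa using add_nonneg (hnn u) (hnn v)
      · simpa [h] using hnn r
    · rcases eq_or_ne r (u + v) with rfl | h
      · exact ⟨Finsupp.single u 1 + Finsupp.single v 1,
          by simp [total_single, total_add, zero_mem], by simp [pairing_single, pairing_add]⟩
      · exact ⟨Finsupp.single r 1, by simp [total_single, zero_mem],
          by simp [pairing_single, h]⟩
  have := hπ.eq_of_le hval fun r => by
    rcases eq_or_ne r (u + v) with rfl | h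
    · simpa using hlt.le
    · simp [h]
  have h2 := congrFun this (u + v)
  simp only [Function.update_self] at h2
  exact hlt.ne h2

lemma IsMinimalValid.periodic {f : E k} {π : E k → ℝ} (hπ : IsMinimalValid f π) (x : E k)
    {z : E k} (hz : z ∈ intLattice k) : π (x + z) = π x := by
  apply le_antisymm
  · simpa [hπ.eq_zero_of_mem hz] using hπ.subadditive x z
  · simpa [hπ.eq_zero_of_mem (neg_mem hz)] using hπ.subadditive (x + z) (-z)

lemma IsMinimalValid.le_pairing {f : E k} {π : E k → ℝ} (hπ : IsMinimalValid f π)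
    (s : E k →₀ ℕ) : π (total s) ≤ pairing π s := by
  refine induction_unit (p := fun s => π (total s) ≤ pairing π s) s ?_ (fun s t hs ht => ?_) fun r => ?_
  · simp [total_zero, pairing_zero, hπ.eq_zero_of_mem (zero_mem _)]
  · rw [total_add, pairing_add]
    exact (hπ.subadditive _ _).trans (add_le_add hs ht)
  · simp [total_single, pairing_single]

lemma IsValid.one_le_add {f : E k} {π : E k → ℝ} (hπ : IsValid f π) (r : E k) :
    1 ≤ π r + π (-f - r) := by
  have := hπ.2 (Finsupp.single r 1 + Finsupp.single (-f - r) 1) (by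
    rw [isFeasible_iff]
    simp [total_add, total_single, zero_mem])
  simpa [pairing_add, pairing_single] using this

/-- If `π r > 0` and `π r + π (-f - r) = 1 + δ` with `δ > 0`, then dividing the value at `r` by
`1 + δ` keeps `π` valid, because every feasible `s` with `s_r ≥ 1` costs at least `1 + δ`. -/
lemma IsMinimalValid.add_le_one_of_pos {f : E k} {π : E k → ℝ} (hπ : IsMinimalValid f π)
    {r : E k} (hr : 0 < π r) : π r + π (-f - r) ≤ 1 := by
  classical
  by_contra! hlt
  have hnn := hπ.1.1
  set D := π r + π (-f - r) with hD
  have hD0 : 0 < D := by linarith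
  have hval : IsValid f (Function.update π r (π r / D)) := by
    refine ⟨fun x => ?_, fun s hs => ?_⟩
    · rcases eq_or_ne x r with rfl | h
      · simp only [Function.update_self]; positivity
      · simpa [h] using hnn x
    · by_cases hsr : s r = 0
      · have : pairing (Function.update π r (π r / D)) s = pairing π s := by
          refine Finset.sum_congr rfl fun x hx => ?_
          have : x ≠ r := by
            rintro rfl
            exact (Finsupp.mem_support_iff.1 hx) hsr
          simp [this]
        rw [this]
        exact hπ.1.2 s hs
      · have hle : Finsupp.single r 1 ≤ s := by
          rw [Finsupp.single_le_iff]; omega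
        have hdec : (s - Finsupp.single r 1) + Finsupp.single r 1 = s := tsub_add_cancel_of_le hle
        have hcost : D ≤ pairing π s := by
          have h1 := hπ.le_pairing (s - Finsupp.single r 1)
          have h2 : π (total (s - Finsupp.single r 1)) = π (-f - r) := by
            have h3 : f + total s ∈ intLattice k := hs
            rw [← hdec, total_add, total_single] at h3
            have h4 := hπ.periodic (-f - r) h3
            rw [← h4]
            congr 1
            simp only [Nat.cast_one, one_smul]
            abel
          rw [← hdec, pairing_add, pairing_single]
          push_cast
          linarith
        have hscale : pairing π s / D ≤ pairing (Function.update π r (π r / D)) s := by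
          unfold pairing Finsupp.sum
          rw [Finset.sum_div]
          refine Finset.sum_le_sum fun x _ => ?_
          rcases eq_or_ne x r with rfl | h
          · simp only [Function.update_self]
            rw [div_mul_eq_mul_div]
          · simp only [ne_eq, h, not_false_eq_true, Function.update_of_ne]
            exact div_le_self (mul_nonneg (hnn x) (Nat.cast_nonneg _)) hlt.le
        refine le_trans ?_ hscale
        rwa [le_div_iff₀ hD0, one_mul]
  have hdrop : π r / D < π r := div_lt_self hr hlt
  have := hπ.eq_of_le hval fun x => by
    rcases eq_or_ne x r with rfl | h
    · simpa using hdrop.le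
    · simp [h]
  have h2 := congrFun this r
  simp only [Function.update_self] at h2
  exact hdrop.ne h2

lemma IsMinimalValid.symmetric {f : E k} {π : E k → ℝ} (hπ : IsMinimalValid f π) (r : E k) :
    π r + π (-f - r) = 1 := by
  refine le_antisymm ?_ (hπ.1.one_le_add r)
  rcases (hπ.1.1 r).eq_or_lt with h | h
  · rcases (hπ.1.1 (-f - r)).eq_or_lt with h' | h'
    · rw [← h, ← h']; norm_num
    · have := hπ.add_le_one_of_pos h'
      rw [sub_sub_cancel] at this
      linarith
  · exact hπ.add_le_one_of_pos h

lemma IsMinimalValid.apply_neg {f : E k} {π : E k → ℝ} (hπ : IsMinimalValid f π) :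
    π (-f) = 1 := by
  simpa [hπ.eq_zero_of_mem (zero_mem _)] using hπ.symmetric 0

/-! ### Valid functions that are tight wherever a minimal one is -/

section Tight

variable {f : E k} {π θ : E k → ℝ}

lemma add_eq_one_of_tight (hπ : IsMinimalValid f π)
    (hS : tightSolutions f π ⊆ tightSolutions f θ) (r : E k) : θ r + θ (-f - r) = 1 := by
  have hmem : Finsupp.single r 1 + Finsupp.single (-f - r) 1 ∈ tightSolutions f π := by
    refine ⟨?_, ?_⟩
    · rw [isFeasible_iff]
      simp [total_add, total_single, zero_mem]
    · simpa [pairing_add, pairing_single] using hπ.symmetric r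
  simpa [pairing_add, pairing_single] using (hS hmem).2

lemma apply_neg_of_tight (hπ : IsMinimalValid f π)
    (hS : tightSolutions f π ⊆ tightSolutions f θ) : θ (-f) = 1 := by
  have hmem : Finsupp.single (-f) 1 ∈ tightSolutions f π := by
    refine ⟨?_, ?_⟩
    · rw [isFeasible_iff]
      simp [total_single, zero_mem]
    · simpa [pairing_single] using hπ.apply_neg
  simpa [pairing_single] using (hS hmem).2

lemma eq_zero_of_tight (hπ : IsMinimalValid f π)
    (hS : tightSolutions f π ⊆ tightSolutions f θ) {z : E k} (hz : z ∈ intLattice k) :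
    θ z = 0 := by
  have hmem : Finsupp.single z 1 + Finsupp.single (-f) 1 ∈ tightSolutions f π := by
    refine ⟨?_, ?_⟩
    · rw [isFeasible_iff]
      simpa [total_add, total_single] using hz
    · simp [pairing_add, pairing_single, hπ.apply_neg, hπ.eq_zero_of_mem hz]
  have := (hS hmem).2
  simpa [pairing_add, pairing_single, apply_neg_of_tight hπ hS] using this

lemma subadditive_of_tight (hπ : IsMinimalValid f π) (hθ : IsValid f θ)
    (hS : tightSolutions f π ⊆ tightSolutions f θ) (u v : E k) : θ (u + v) ≤ θ u + θ v := by
  have h1 := hθ.2 (Finsupp.single u 1 + Finsupp.single v 1 + Finsupp.single (-f - (u + v)) 1) (by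
    rw [isFeasible_iff]
    simp [total_add, total_single, zero_mem])
  simp only [pairing_add, pairing_single, Nat.cast_one, mul_one] at h1
  linarith [add_eq_one_of_tight hπ hS (u + v)]

lemma additive_of_tight (hπ : IsMinimalValid f π)
    (hS : tightSolutions f π ⊆ tightSolutions f θ) {u v : E k} (huv : π (u + v) = π u + π v) :
    θ (u + v) = θ u + θ v := by
  have hmem : Finsupp.single u 1 + Finsupp.single v 1 + Finsupp.single (-f - (u + v)) 1 ∈
      tightSolutions f π := by
    refine ⟨?_, ?_⟩
    · rw [isFeasible_iff]
      simp [total_add, total_single, zero_mem]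
    · simp only [pairing_add, pairing_single, Nat.cast_one, mul_one]
      rw [← huv]
      exact hπ.symmetric (u + v)
  have h1 := (hS hmem).2
  simp only [pairing_add, pairing_single, Nat.cast_one, mul_one] at h1
  linarith [add_eq_one_of_tight hπ hS (u + v)]

end Tight

lemma pairing_midpoint {π π₁ π₂ : E k → ℝ} (h : ∀ r, π r = 1 / 2 * π₁ r + 1 / 2 * π₂ r)
    (s : E k →₀ ℕ) : pairing π s = 1 / 2 * pairing π₁ s + 1 / 2 * pairing π₂ s := by
  unfold pairing Finsupp.sum
  rw [Finset.mul_sum, Finset.mul_sum, ← Finset.sum_add_distrib]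
  exact Finset.sum_congr rfl fun r _ => by simp only [h]; ring

lemma IsFacet.isExtremeFunction {f : E k} {π : E k → ℝ} (hπ : IsFacet f π) :
    IsExtremeFunction f π := by
  refine ⟨hπ.1, fun π₁ π₂ h₁ h₂ h => ⟨?_, ?_⟩⟩
  · refine (hπ.2 π₁ h₁ fun s hs => ⟨hs.1, ?_⟩).symm
    linarith [pairing_midpoint h s, h₁.2 s hs.1, h₂.2 s hs.1, hs.2]
  · refine (hπ.2 π₂ h₂ fun s hs => ⟨hs.1, ?_⟩).symm
    linarith [pairing_midpoint h s, h₁.2 s hs.1, h₂.2 s hs.1, hs.2]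

/-! ### Maximal cells of a locally finite complex -/

lemma IsPolyhedron.convex {P : Set (E k)} (hP : IsPolyhedron P) : Convex ℝ P := by
  obtain ⟨n, a, b, rfl⟩ := hP
  simp only [Set.ofPred_forall]
  exact convex_iInter fun i => convex_halfSpace_le (innerSL ℝ (a i)).isLinear (b i)

lemma IsPolyhedron.isClosed {P : Set (E k)} (hP : IsPolyhedron P) : IsClosed P := by
  obtain ⟨n, a, b, rfl⟩ := hP
  simp only [Set.ofPred_forall]
  exact isClosed_iInter fun i => isClosed_le (by fun_prop) continuous_const

/-- A face of a convex set that contains a neighbourhood of one of its points is the whole set: the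
functional it maximizes is constant near that point. -/
lemma subset_of_isFaceOf {F P : Set (E k)} (hP : Convex ℝ P) (hF : IsFaceOf F P) {r : E k} {ε : ℝ}
    (hε : 0 < ε) (hr : r ∈ F) (hball : P ∩ Metric.ball r ε ⊆ F) : P ⊆ F := by
  obtain ⟨l, rfl⟩ := hF ⟨r, hr⟩
  intro x hx
  obtain ⟨t, ht0, ht1, htx⟩ : ∃ t : ℝ, 0 < t ∧ t ≤ 1 ∧ r + t • (x - r) ∈ Metric.ball r ε := by
    have hc : Filter.Tendsto (fun t : ℝ => r + t • (x - r)) (nhdsWithin 0 (Set.Ioi 0))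
        (nhds r) := by
      have : Continuous fun t : ℝ => r + t • (x - r) := by fun_prop
      simpa using (this.tendsto 0).mono_left nhdsWithin_le_nhds
    obtain ⟨t, h1, h2⟩ := ((hc.eventually (Metric.ball_mem_nhds r hε)).and
      (Ioc_mem_nhdsGT (zero_lt_one (α := ℝ)))).exists
    exact ⟨t, h2.1, h2.2, h1⟩
  have hmem : r + t • (x - r) ∈ P := hP.add_smul_sub_mem hr.1 hx ⟨ht0.le, ht1⟩
  have h1 := (hball ⟨hmem, htx⟩).2 r hr.1
  simp only [map_add, map_smul, map_sub, smul_eq_mul, le_add_iff_nonneg_right] at h1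
  have h2 : l r ≤ l x := by
    have := nonneg_of_mul_nonneg_right h1 ht0
    linarith
  exact ⟨hx, fun y hy => (hr.2 y hy).trans h2⟩

/-- The cells through `r` are finitely many, as each is determined by its part near `r`, and every
cell that meets a small ball around `r` contains `r`. -/
lemma exists_ball_of_isLocallyFiniteComplex {𝒞 : Set (Set (E k))} (hc : IsPolyhedralComplex 𝒞)
    (hlf : IsLocallyFiniteComplex 𝒞) (r : E k) :
    ∃ ε : ℝ, 0 < ε ∧ (∀ P ∈ 𝒞, (P ∩ Metric.ball r ε).Nonempty → r ∈ P) ∧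
      {P ∈ 𝒞 | r ∈ P}.Finite := by
  obtain ⟨ε, hε, ℱ, hℱ, heq⟩ := hlf r
  refine ⟨ε, hε, fun P hP hne => ?_, ?_⟩
  · have hmem : P ∩ Metric.ball r ε ∈ restrictCells 𝒞 (Metric.ball r ε) := ⟨hne, P, hP, rfl⟩
    rw [heq] at hmem
    obtain ⟨-, Q, ⟨C, hC, rfl⟩, hQ⟩ := hmem
    have hCne : C.Nonempty := by
      rw [hQ] at hne
      obtain ⟨-, ⟨y, hy, -⟩, -⟩ := hne
      exact ⟨y, hy⟩
    have : r ∈ P ∩ Metric.ball r ε := by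
      rw [hQ]
      exact ⟨⟨0, (hℱ.cone C hC hCne).1, by simp⟩, Metric.mem_ball_self hε⟩
    exact this.1
  · have hfin : (restrictCells 𝒞 (Metric.ball r ε)).Finite := by
      rw [heq]
      refine ((hℱ.finite.image fun C : Set (E k) => (fun x => x + r) '' C).image
        fun P => P ∩ Metric.ball r ε).subset ?_
      rintro Y ⟨-, P, hP, rfl⟩
      exact ⟨P, hP, rfl⟩
    refine Set.Finite.of_injOn (f := fun P => P ∩ Metric.ball r ε) ?_ ?_ hfin
    · rintro P ⟨hP, hrP⟩
      exact ⟨⟨r, hrP, Metric.mem_ball_self hε⟩, P, hP, rfl⟩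
    · rintro P ⟨hP, hrP⟩ Q ⟨hQ, hrQ⟩ hPQ
      have hPQ' : P ∩ Metric.ball r ε = Q ∩ Metric.ball r ε := hPQ
      apply Set.Subset.antisymm
      · refine (subset_of_isFaceOf (hc.polyhedron P hP).convex (hc.inter_left P hP Q hQ) hε
          ⟨hrP, hrQ⟩ fun x hx => ⟨hx.1, ?_⟩).trans Set.inter_subset_right
        rw [hPQ'] at hx
        exact hx.1
      · refine (subset_of_isFaceOf (hc.polyhedron Q hQ).convex (hc.inter_right P hP Q hQ) hε
          ⟨hrP, hrQ⟩ fun x hx => ⟨?_, hx.1⟩).trans Set.inter_subset_left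
        rw [← hPQ'] at hx
        exact hx.1

lemma exists_maximalCell_mem {𝒞 : Set (Set (E k))} (hc : IsPolyhedralComplex 𝒞)
    (hcomplete : IsCompleteComplex 𝒞) (hlf : IsLocallyFiniteComplex 𝒞) (r : E k) :
    ∃ ε : ℝ, 0 < ε ∧ ∀ x ∈ Metric.ball r ε, ∃ P, IsMaximalCell 𝒞 P ∧ r ∈ P ∧ x ∈ P := by
  obtain ⟨ε, hε, hmeet, hfin⟩ := exists_ball_of_isLocallyFiniteComplex hc hlf r
  refine ⟨ε, hε, fun x hx => ?_⟩
  obtain ⟨P, hP, hxP⟩ : ∃ P ∈ 𝒞, x ∈ P := by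
    have : x ∈ ⋃₀ 𝒞 := by rw [hcomplete]; trivial
    exact this
  have hrP := hmeet P hP ⟨x, hxP, hx⟩
  obtain ⟨Q, hPQ, hQ⟩ := hfin.exists_le_maximal ⟨hP, hrP⟩
  exact ⟨Q, ⟨hQ.prop.1, fun R hR hQR => (hQ.eq_of_ge ⟨hR, hQR hQ.prop.2⟩ hQR)⟩,
    hQ.prop.2, hPQ hxP⟩

/-- Gradients on a cell are determined only modulo vectors orthogonal to it; so if there are
finitely many gradients, the maximal cells are full-dimensional. -/
lemma interior_nonempty_of_finite_gradientSet {θ : E k → ℝ} {𝒞 : Set (Set (E k))}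
    (hpl : IsPiecewiseLinear θ 𝒞) (hfin : (gradientSet θ 𝒞).Finite) {P : Set (E k)}
    (hP : IsMaximalCell 𝒞 P) (hne : P.Nonempty) : (interior P).Nonempty := by
  rw [(hpl.complex.polyhedron P hP.1).convex.interior_nonempty_iff_affineSpan_eq_top,
    AffineSubspace.affineSpan_eq_top_iff_vectorSpan_eq_top_of_nonempty ℝ _ _ hne]
  by_contra hne_top
  have horth : (vectorSpan ℝ P)ᗮ ≠ ⊥ := fun h => hne_top (Submodule.orthogonal_eq_bot_iff.1 h)
  obtain ⟨v, hv, hv0⟩ := Submodule.exists_mem_ne_zero_of_ne_bot horth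
  obtain ⟨g, δ, hg⟩ := hpl.affine P hP
  obtain ⟨p, hp⟩ := hne
  refine (Set.infinite_range_of_injective (f := fun t : ℝ => g + t • v) ?_).mono ?_ hfin
  · intro s t hst
    exact smul_left_injective ℝ hv0 (add_left_cancel hst)
  · rintro _ ⟨t, rfl⟩
    refine ⟨P, hP, δ - t * inner ℝ v p, fun r hr => ?_⟩
    have h0 : inner ℝ v (r - p) = 0 := by
      rw [real_inner_comm]
      exact hv _ (vsub_mem_vectorSpan ℝ hr hp)
    rw [inner_sub_right] at h0
    rw [hg r hr, inner_add_left, real_inner_smul_left, show inner ℝ v r = inner ℝ v p by linarith]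
    ring

/-- What the argument uses of a piecewise linear function with finitely many gradients: a family of
closed convex full-dimensional cells such that `θ` has on each of them a gradient from `G`, and such
that each point of some ball around `r` shares a cell with `r`. -/
structure HasCells (θ : E k → ℝ) (G : Set (E k)) (M : Set (Set (E k))) : Prop where
  convex : ∀ P ∈ M, Convex ℝ P
  isClosed : ∀ P ∈ M, IsClosed P
  interior_nonempty : ∀ P ∈ M, (interior P).Nonempty
  gradient : ∀ P ∈ M, ∃ g ∈ G, HasGradientOn θ P g
  exists_ball : ∀ r, ∃ ε : ℝ, 0 < ε ∧ ∀ x ∈ Metric.ball r ε, ∃ P ∈ M, r ∈ P ∧ x ∈ P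

lemma IsPiecewiseLinear.hasCells {θ : E k → ℝ} {𝒞 : Set (Set (E k))}
    (hpl : IsPiecewiseLinear θ 𝒞) (hlf : IsLocallyFiniteComplex 𝒞)
    (hfin : (gradientSet θ 𝒞).Finite) :
    HasCells θ (gradientSet θ 𝒞) {P | IsMaximalCell 𝒞 P ∧ P.Nonempty} where
  convex P hP := (hpl.complex.polyhedron P hP.1.1).convex
  isClosed P hP := (hpl.complex.polyhedron P hP.1.1).isClosed
  interior_nonempty P hP := interior_nonempty_of_finite_gradientSet hpl hfin hP.1 hP.2
  gradient P hP := by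
    obtain ⟨g, hg⟩ := hpl.affine P hP.1
    exact ⟨g, ⟨P, hP.1, hg⟩, hg⟩
  exists_ball r := by
    obtain ⟨ε, hε, h⟩ := exists_maximalCell_mem hpl.complex hpl.complete hlf r
    refine ⟨ε, hε, fun x hx => ?_⟩
    obtain ⟨P, hP, hr, hx⟩ := h x hx
    exact ⟨P, ⟨hP, ⟨r, hr⟩⟩, hr, hx⟩

/-! ### Continuity and positivity near the origin -/

lemma HasGradientOn.sub_eq {θ : E k → ℝ} {P : Set (E k)} {g : E k} (h : HasGradientOn θ P g)
    {x y : E k} (hx : x ∈ P) (hy : y ∈ P) : θ x - θ y = inner ℝ g (x - y) := by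
  obtain ⟨δ, hδ⟩ := h
  rw [hδ x hx, hδ y hy, inner_sub_right]
  ring

lemma HasCells.continuous {θ : E k → ℝ} {G : Set (E k)} {M : Set (Set (E k))}
    (h : HasCells θ G M) (hG : G.Finite) : Continuous θ := by
  obtain ⟨K, hK⟩ := hG.isBounded.exists_norm_le
  rw [continuous_iff_continuousAt]
  intro r
  obtain ⟨ε, hε, hball⟩ := h.exists_ball r
  have hlim : Filter.Tendsto (fun x => K * ‖x - r‖) (nhds r) (nhds 0) := by
    have : Continuous fun x : E k => K * ‖x - r‖ := by fun_prop
    simpa using this.tendsto r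
  refine tendsto_iff_norm_sub_tendsto_zero.2 (squeeze_zero' (Filter.Eventually.of_forall
    fun _ => norm_nonneg _) ?_ hlim)
  filter_upwards [Metric.ball_mem_nhds r hε] with x hx
  obtain ⟨P, hP, hrP, hxP⟩ := hball x hx
  obtain ⟨g, hg, hgP⟩ := h.gradient P hP
  rw [hgP.sub_eq hxP hrP]
  exact (norm_inner_le_norm _ _).trans (mul_le_mul_of_nonneg_right (hK g hg) (norm_nonneg _))

/-- Recurrence in the torus `ℝ^k / ℤ^k`: some positive multiple of `y` is close to a lattice
point. -/
lemma exists_nsmul_near_intLattice (y : E k) {δ : ℝ} (hδ : 0 < δ) :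
    ∃ n : ℕ, 1 ≤ n ∧ ∃ z ∈ intLattice k, ‖n • y - z‖ < δ := by
  let a : ℕ → E k := fun n => WithLp.toLp 2 fun i => Int.fract ((n : ℝ) * y i)
  have hcomp : IsCompact (WithLp.toLp 2 '' Set.Icc (0 : Fin k → ℝ) 1 : Set (E k)) :=
    isCompact_Icc.image (PiLp.continuous_toLp 2 _)
  have ha : ∀ n, a n ∈ (WithLp.toLp 2 '' Set.Icc (0 : Fin k → ℝ) 1 : Set (E k)) := fun n =>
    ⟨_, ⟨fun i => Int.fract_nonneg _, fun i => (Int.fract_lt_one _).le⟩, rfl⟩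
  obtain ⟨b, -, φ, hφ, hlim⟩ := hcomp.tendsto_subseq ha
  obtain ⟨N, hN⟩ := Metric.cauchySeq_iff.1 hlim.cauchySeq δ hδ
  have hlt : φ N < φ (N + 1) := hφ (Nat.lt_succ_self N)
  refine ⟨φ (N + 1) - φ N, by omega,
    WithLp.toLp 2 fun i => ((⌊(φ (N + 1) : ℝ) * y i⌋ - ⌊(φ N : ℝ) * y i⌋ : ℤ) : ℝ),
    ⟨_, fun i => rfl⟩, ?_⟩
  have h1 := hN (N + 1) (by omega) N le_rfl
  rw [dist_eq_norm] at h1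
  refine lt_of_eq_of_lt (congrArg _ ?_) h1
  ext i
  simp only [PiLp.sub_apply, PiLp.smul_apply, nsmul_eq_mul, Nat.cast_sub hlt.le, Int.cast_sub,
    Function.comp_apply, a, Int.fract]
  ring

/-- A function that is invariant in a direction factors through a quotient by a line. -/
lemma not_genuinelyKDimensional_of_invariant {θ : E k → ℝ} {v : E k} (hv : v ≠ 0)
    (h : ∀ x, ∀ t : ℝ, θ (x + t • v) = θ x) : ¬ GenuinelyKDimensional θ := by
  intro hgen
  refine hgen ?_
  have hrank : Module.finrank ℝ (E k ⧸ Submodule.span ℝ {v}) = Module.finrank ℝ (E (k - 1)) := by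
    have h1 := Submodule.finrank_quotient_add_finrank (Submodule.span ℝ {v})
    rw [finrank_span_singleton hv, finrank_euclideanSpace_fin] at h1
    rw [finrank_euclideanSpace_fin]
    omega
  let e := LinearEquiv.ofFinrankEq (R := ℝ) _ _ hrank
  let T : E k →ₗ[ℝ] E (k - 1) := e.toLinearMap ∘ₗ (Submodule.span ℝ {v}).mkQ
  have hT : Function.Surjective T := e.surjective.comp (Submodule.mkQ_surjective _)
  refine ⟨fun y => θ (Function.surjInv hT y), T, funext fun x => ?_⟩
  have h1 : T (Function.surjInv hT (T x)) = T x := Function.surjInv_eq hT _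
  have h2 := (Submodule.Quotient.eq _).1 (e.injective h1)
  obtain ⟨t, ht⟩ := Submodule.mem_span_singleton.1 h2
  have h3 : Function.surjInv hT (T x) = x + t • v := by rw [ht]; abel
  simp only [Function.comp_apply]
  rw [h3, h]

/-- A nonnegative continuous subadditive `ℤ^k`-periodic function that vanishes on a segment
`[0, x]` vanishes on the ray through `x`, hence, by recurrence, on the line through `x`, and so is
invariant in the direction `x`. -/
lemma not_genuinelyKDimensional_of_segment {π : E k → ℝ} (hnn : ∀ r, 0 ≤ π r)
    (hsub : ∀ u v, π (u + v) ≤ π u + π v)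
    (hper : ∀ x, ∀ z ∈ intLattice k, π (x + z) = π x) (hcont : Continuous π) {x : E k}
    (hx : x ≠ 0) (hseg : ∀ t : ℝ, 0 ≤ t → t ≤ 1 → π (t • x) = 0) :
    ¬ GenuinelyKDimensional π := by
  have h0 : π 0 = 0 := by simpa using hseg 0 le_rfl zero_le_one
  have hmul : ∀ (n : ℕ) (y : E k), π (n • y) ≤ n * π y := by
    intro n y
    induction n with
    | zero => simp [h0]
    | succ n ih =>
      rw [succ_nsmul]
      push_cast
      linarith [hsub (n • y) y]
  have hray : ∀ t : ℝ, 0 ≤ t → π (t • x) = 0 := by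
    intro t ht
    obtain ⟨n, hn⟩ := exists_nat_gt t
    have hn0 : (0 : ℝ) < n := ht.trans_lt hn
    have h1 := hmul n ((t / n) • x)
    rw [hseg (t / n) (by positivity) ((div_le_one hn0).2 hn.le), mul_zero,
      ← Nat.cast_smul_eq_nsmul ℝ, smul_smul, mul_div_cancel₀ _ hn0.ne'] at h1
    exact le_antisymm h1 (hnn _)
  have hneg : ∀ t : ℝ, 0 ≤ t → π (-(t • x)) = 0 := by
    intro t ht
    by_contra hne
    have hpos : 0 < π (-(t • x)) := lt_of_le_of_ne (hnn _) (Ne.symm hne)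
    obtain ⟨δ, hδ, hclose⟩ := Metric.continuous_iff.1 hcont (-(t • x)) _ hpos
    obtain ⟨n, hn, z, hz, hnz⟩ := exists_nsmul_near_intLattice (t • x) hδ
    have h1 := hclose (-(t • x) + (n • (t • x) - z)) (by simpa [dist_eq_norm] using hnz)
    have h2 : π (-(t • x) + (n • (t • x) - z)) = 0 := by
      have h3 : -(t • x) + (n • (t • x) - z) = (((n - 1 : ℕ) : ℝ) * t) • x + -z := by
        rw [← Nat.cast_smul_eq_nsmul ℝ, Nat.cast_sub hn]
        push_cast
        module
      rw [h3, hper _ _ (neg_mem hz)]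
      exact hray _ (by positivity)
    rw [h2, Real.dist_eq, zero_sub, abs_neg, abs_of_pos hpos] at h1
    exact lt_irrefl _ h1
  have hline : ∀ t : ℝ, π (t • x) = 0 := by
    intro t
    rcases le_total 0 t with h | h
    · exact hray t h
    · simpa using hneg (-t) (neg_nonneg.2 h)
  refine not_genuinelyKDimensional_of_invariant hx fun y t => le_antisymm ?_ ?_
  · simpa [hline t] using hsub y (t • x)
  · have h := hsub (y + t • x) ((-t) • x)
    rw [hline (-t)] at h
    simpa using h

/-! ### The shape of the function near the origin -/

/-- Near the origin `π` is the maximum of the linear functions given by the gradients `G₀` of the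
cells through the origin. -/
lemma HasCells.exists_eq_max {π : E k → ℝ} {G : Set (E k)} {M : Set (Set (E k))}
    (h : HasCells π G M) (h0 : π 0 = 0) (hsub : ∀ u v, π (u + v) ≤ π u + π v) :
    ∃ G₀ ⊆ G, ∃ ε : ℝ, 0 < ε ∧ ∀ x, ‖x‖ < ε →
      (∃ g ∈ G₀, π x = inner ℝ g x) ∧ ∀ g ∈ G₀, inner ℝ g x ≤ π x := by
  obtain ⟨ε, hε, hball⟩ := h.exists_ball 0
  have hlin : ∀ P g, 0 ∈ P → HasGradientOn π P g → ∀ x ∈ P, π x = inner ℝ g x := by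
    intro P g h0P hg x hx
    simpa [h0] using hg.sub_eq hx h0P
  refine ⟨{g ∈ G | ∃ P ∈ M, 0 ∈ P ∧ HasGradientOn π P g}, fun g hg => hg.1, ε, hε,
    fun x hx => ?_⟩
  obtain ⟨P, hP, h0P, hxP⟩ := hball x (by simpa using hx)
  obtain ⟨g, hgG, hg⟩ := h.gradient P hP
  refine ⟨⟨g, ⟨hgG, P, hP, h0P, hg⟩, hlin P g h0P hg x hxP⟩, ?_⟩
  rintro g' ⟨-, Q, hQ, h0Q, hg'⟩
  -- Compare the values at an interior point `p` of `Q` and at `p + t • x` for a small `t > 0`.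
  obtain ⟨p, hp⟩ := h.interior_nonempty Q hQ
  have hc : Filter.Tendsto (fun t : ℝ => p + t • x) (nhdsWithin 0 (Set.Ioi 0)) (nhds p) := by
    have : Continuous fun t : ℝ => p + t • x := by fun_prop
    simpa using (this.tendsto 0).mono_left nhdsWithin_le_nhds
  obtain ⟨t, ht, ht0, ht1⟩ := ((hc.eventually (isOpen_interior.mem_nhds hp)).and
    (Ioc_mem_nhdsGT (zero_lt_one (α := ℝ)))).exists
  have htP : t • x ∈ P := by
    simpa using (h.convex P hP).add_smul_sub_mem h0P hxP ⟨ht0.le, ht1⟩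
  have h1 := hsub p (t • x)
  rw [hlin Q g' h0Q hg' _ (interior_subset ht), hlin Q g' h0Q hg' _ (interior_subset hp),
    hlin P g h0P hg _ htP, inner_add_right, inner_smul_right, inner_smul_right,
    ← hlin P g h0P hg _ hxP] at h1
  exact le_of_mul_le_mul_left (by linarith) ht0

/-- If a maximum of linear functions is positive near the origin except at it, its gradients affinely
span the space: no nonzero affine function `⟨·, x⟩ + t` vanishes on them, since `-t` would be the
maximum in both of the directions `x` and `-x`. -/
lemma eq_zero_of_inner_add_eq_zero {π : E k → ℝ} {G : Set (E k)} {ε : ℝ} (hε : 0 < ε)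
    (hloc : ∀ x, ‖x‖ < ε → ∃ g ∈ G, π x = inner ℝ g x)
    (hpos : ∀ x, x ≠ 0 → ‖x‖ < ε → 0 < π x) {x : E k} {t : ℝ}
    (h : ∀ g ∈ G, inner ℝ g x + t = 0) : x = 0 ∧ t = 0 := by
  by_cases hx : x = 0
  · obtain ⟨g, hg, -⟩ := hloc 0 (by simpa using hε)
    exact ⟨hx, by simpa [hx] using h g hg⟩
  · exfalso
    obtain ⟨s, hs0, hs⟩ : ∃ s : ℝ, 0 < s ∧ ‖s • x‖ < ε := by
      have hnx : 0 < ‖x‖ := norm_pos_iff.2 hx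
      refine ⟨ε / (2 * ‖x‖), by positivity, ?_⟩
      rw [norm_smul, Real.norm_of_nonneg (by positivity)]
      field_simp
      linarith
    have hsx : s • x ≠ 0 := smul_ne_zero hs0.ne' hx
    have h1 : 0 < -t := by
      have h2 := hpos _ hsx hs
      obtain ⟨g, hg, hge⟩ := hloc _ hs
      rw [hge, inner_smul_right] at h2
      linarith [h g hg, pos_of_mul_pos_right h2 hs0.le]
    have h1' : 0 < t := by
      have h2 := hpos (-(s • x)) (neg_ne_zero.2 hsx) (by rwa [norm_neg])
      obtain ⟨g, hg, hge⟩ := hloc (-(s • x)) (by rwa [norm_neg])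
      rw [hge, inner_neg_right, inner_smul_right, ← mul_neg] at h2
      linarith [h g hg, pos_of_mul_pos_right h2 hs0.le]
    linarith

/-- The linear map `(x, t) ↦ (⟨gᵢ, x⟩ + t)ᵢ`. Its injectivity says that the `gᵢ` affinely span the
space, its surjectivity that they are affinely independent. -/
noncomputable def innerAdd {ι : Type*} (g : ι → E k) : (E k × ℝ) →ₗ[ℝ] (ι → ℝ) :=
  LinearMap.pi fun i => ((innerSL ℝ (g i)).toLinearMap).coprod LinearMap.id

lemma innerAdd_apply {ι : Type*} (g : ι → E k) (p : E k × ℝ) (i : ι) :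
    innerAdd g p i = inner ℝ (g i) p.1 + p.2 := by
  simp [innerAdd]

lemma innerAdd_injective {ι : Type*} {g : ι → E k}
    (h : ∀ (x : E k) (t : ℝ), (∀ i, inner ℝ (g i) x + t = 0) → x = 0 ∧ t = 0) :
    Function.Injective (innerAdd g) := by
  rw [injective_iff_map_eq_zero]
  rintro ⟨x, t⟩ hxt
  have := h x t fun i => by simpa [innerAdd_apply] using congrFun hxt i
  simp [this.1, this.2]

lemma finrank_prod_real : Module.finrank ℝ (E k × ℝ) = k + 1 := by
  simp

/-! ### Rigidity near the origin -/

/-- Cauchy's functional equation on `[0, 1]` for nonnegative functions. -/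
lemma eq_mul_of_additive_Icc {F : ℝ → ℝ} (hnn : ∀ t, 0 ≤ F t)
    (hadd : ∀ a b, 0 ≤ a → 0 ≤ b → a + b ≤ 1 → F (a + b) = F a + F b) {t : ℝ} (ht0 : 0 ≤ t)
    (ht1 : t ≤ 1) : F t = t * F 1 := by
  have hF0 : F 0 = 0 := by
    have := hadd 0 0 le_rfl le_rfl (by norm_num)
    rw [add_zero] at this
    linarith
  have hmul : ∀ (n : ℕ) (a : ℝ), 0 ≤ a → n * a ≤ 1 → F (n * a) = n * F a := by
    intro n a ha hna
    induction n with
    | zero => simp [hF0]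
    | succ n ih =>
      push_cast at hna ⊢
      rw [add_mul, one_mul] at hna ⊢
      rw [hadd _ _ (by positivity) ha hna, ih (by linarith)]
      ring
  have hlow : ∀ s, 0 ≤ s → s ≤ 1 → s * F 1 ≤ F s := by
    intro s hs0 hs1
    refine le_of_forall_pos_le_add fun η hη => ?_
    obtain ⟨n, hn⟩ := exists_nat_gt (F 1 / η)
    have hn0 : (0 : ℝ) < n := (div_nonneg (hnn 1) hη.le).trans_lt hn
    set m := ⌊s * n⌋₊ with hm
    have hm1 : (m : ℝ) ≤ s * n := Nat.floor_le (by positivity)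
    have hm2 : s * n < m + 1 := Nat.lt_floor_add_one _
    have hms : (m : ℝ) * (1 / n) ≤ s := by
      rw [mul_one_div, div_le_iff₀ hn0]; exact hm1
    have h1 : F 1 = n * F (1 / n) := by
      rw [← hmul n (1 / n) (by positivity) (by rw [mul_one_div_cancel hn0.ne']),
        mul_one_div_cancel hn0.ne']
    have h2 : F (m * (1 / n)) = m * F (1 / n) := hmul m _ (by positivity) (hms.trans hs1)
    have h3 := hadd (m * (1 / n)) (s - m * (1 / n)) (by positivity) (by linarith) (by linarith)
    rw [add_sub_cancel, h2] at h3
    have h4 := hnn (s - m * (1 / n))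
    have h5 : F (1 / n) ≤ η := by
      rw [div_lt_iff₀ hη] at hn
      have : n * F (1 / n) ≤ n * η := by rw [← h1]; exact hn.le
      exact le_of_mul_le_mul_left this hn0
    have h6 : s * F 1 ≤ (m + 1) * F (1 / n) := by
      rw [h1, ← mul_assoc]
      exact mul_le_mul_of_nonneg_right hm2.le (hnn _)
    linarith
  have h1 := hlow t ht0 ht1
  have h2 := hlow (1 - t) (by linarith) (by linarith)
  have h3 := hadd t (1 - t) ht0 (by linarith) (by linarith)
  rw [add_sub_cancel] at h3
  linarith

/-- The cone on which `gᵢ` attains the maximum of the linear functions `⟨gⱼ, ·⟩`. -/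
def maxCone {ι : Type*} (g : ι → E k) (i : ι) : Set (E k) :=
  {x | ∀ j, inner ℝ (g j) x ≤ inner ℝ (g i) x}

section Rigidity

variable {ι : Type*} {g : ι → E k} {i : ι}

lemma zero_mem_maxCone : (0 : E k) ∈ maxCone g i := fun j => by simp

lemma add_mem_maxCone {x y : E k} (hx : x ∈ maxCone g i) (hy : y ∈ maxCone g i) :
    x + y ∈ maxCone g i := fun j => by
  rw [inner_add_right, inner_add_right]
  exact add_le_add (hx j) (hy j)

lemma smul_mem_maxCone {x : E k} (hx : x ∈ maxCone g i) {t : ℝ} (ht : 0 ≤ t) :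
    t • x ∈ maxCone g i := fun j => by
  rw [inner_smul_right, inner_smul_right]
  exact mul_le_mul_of_nonneg_left (hx j) ht

variable {π θ : E k → ℝ} {ε : ℝ}

lemma eq_inner_of_mem_maxCone
    (hloc : ∀ x, ‖x‖ < ε → (∃ i, π x = inner ℝ (g i) x) ∧ ∀ i, inner ℝ (g i) x ≤ π x)
    {x : E k} (hx : x ∈ maxCone g i) (hxε : ‖x‖ < ε) : π x = inner ℝ (g i) x := by
  obtain ⟨⟨j, hj⟩, hmax⟩ := hloc x hxε
  exact le_antisymm (hj ▸ hx j) (hmax i)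

lemma additive_of_mem_maxCone
    (hloc : ∀ x, ‖x‖ < ε → (∃ i, π x = inner ℝ (g i) x) ∧ ∀ i, inner ℝ (g i) x ≤ π x)
    (hadd : ∀ u v, π (u + v) = π u + π v → θ (u + v) = θ u + θ v)
    {x y : E k} (hx : x ∈ maxCone g i) (hy : y ∈ maxCone g i) (hxy : ‖x‖ + ‖y‖ < ε) :
    θ (x + y) = θ x + θ y := by
  apply hadd
  rw [eq_inner_of_mem_maxCone hloc hx (by linarith [norm_nonneg y]),
    eq_inner_of_mem_maxCone hloc hy (by linarith [norm_nonneg x]),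
    eq_inner_of_mem_maxCone hloc (add_mem_maxCone hx hy) ((norm_add_le _ _).trans_lt hxy),
    inner_add_right]

lemma smul_of_mem_maxCone
    (hloc : ∀ x, ‖x‖ < ε → (∃ i, π x = inner ℝ (g i) x) ∧ ∀ i, inner ℝ (g i) x ≤ π x)
    (hnn : ∀ x, 0 ≤ θ x)
    (hadd : ∀ u v, π (u + v) = π u + π v → θ (u + v) = θ u + θ v)
    {x : E k} (hx : x ∈ maxCone g i) (hxε : ‖x‖ < ε) {t : ℝ} (ht0 : 0 ≤ t) (ht1 : t ≤ 1) :
    θ (t • x) = t * θ x := by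
  have := eq_mul_of_additive_Icc (F := fun s => θ (s • x)) (fun s => hnn _)
    (fun a b ha hb hab => ?_) ht0 ht1
  · simpa using this
  · simp only [add_smul]
    refine additive_of_mem_maxCone hloc hadd (smul_mem_maxCone hx ha) (smul_mem_maxCone hx hb) ?_
    rw [norm_smul, norm_smul, Real.norm_of_nonneg ha, Real.norm_of_nonneg hb, ← add_mul]
    exact (mul_le_of_le_one_left (norm_nonneg _) hab).trans_lt hxε

lemma sum_of_mem_maxCone {κ : Type*}
    (hloc : ∀ x, ‖x‖ < ε → (∃ i, π x = inner ℝ (g i) x) ∧ ∀ i, inner ℝ (g i) x ≤ π x)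
    (hadd : ∀ u v, π (u + v) = π u + π v → θ (u + v) = θ u + θ v) (h0 : θ 0 = 0)
    {y : κ → E k} (hy : ∀ l, y l ∈ maxCone g i) (s : Finset κ) (hs : ∑ l ∈ s, ‖y l‖ < ε) :
    θ (∑ l ∈ s, y l) = ∑ l ∈ s, θ (y l) := by
  classical
  induction s using Finset.induction_on with
  | empty => simpa using h0
  | insert a s ha ih =>
    rw [Finset.sum_insert ha] at hs ⊢
    rw [Finset.sum_insert ha, ← ih (by linarith [norm_nonneg (y a)])]
    refine additive_of_mem_maxCone hloc hadd (hy a) ?_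
      ((add_le_add_right (norm_sum_le _ _) _).trans_lt hs)
    exact Finset.sum_induction y (· ∈ maxCone g i) (fun _ _ => add_mem_maxCone)
      zero_mem_maxCone fun l _ => hy l

/-- If `π` is near the origin the maximum of `⟨gᵢ, ·⟩` for affinely independent spanning `gᵢ`, and
`θ ≥ 0` is additive wherever `π` is, then near the origin `θ` is a linear function plus a multiple
of `π`. The cones `maxCone g i` are simplicial with rays among the `X l` below, so that `θ` is
determined near the origin by its slopes `a l` along these `k + 1` rays, and every choice of
slopes is realized by such a sum. -/
lemma exists_eq_inner_add_mul [Fintype ι] (hbij : Function.Bijective (innerAdd g)) (hε : 0 < ε)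
    (hloc : ∀ x, ‖x‖ < ε → (∃ i, π x = inner ℝ (g i) x) ∧ ∀ i, inner ℝ (g i) x ≤ π x)
    (hnn : ∀ x, 0 ≤ θ x)
    (hadd : ∀ u v, π (u + v) = π u + π v → θ (u + v) = θ u + θ v) (h0 : θ 0 = 0) :
    ∃ (h : E k) (c ε' : ℝ), 0 < ε' ∧ ∀ x, ‖x‖ < ε' → θ x = inner ℝ h x + c * π x := by
  classical
  choose X hX using fun l => hbij.2 (-Pi.single l (1 : ℝ))
  have hXval : ∀ l j, inner ℝ (g j) (X l).1 + (X l).2 = if j = l then -1 else 0 := by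
    intro l j
    rw [← innerAdd_apply, hX]
    by_cases hjl : j = l
    · subst hjl; simp
    · simp [hjl]
  have hXcone : ∀ i l, l ≠ i → (X l).1 ∈ maxCone g i := by
    intro i l hli j
    have h1 := hXval l i
    have h2 := hXval l j
    rw [if_neg (Ne.symm hli)] at h1
    split_ifs at h2 <;> linarith
  -- `ρ` is so small that `ρ • X l`, and any sum of such vectors, stays in the ball of radius `ε`.
  set B : ℝ := 1 + ∑ l, ‖(X l).1‖ with hB
  have hsum0 : 0 ≤ ∑ l, ‖(X l).1‖ := Finset.sum_nonneg fun l _ => norm_nonneg _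
  have hB0 : 0 < B := by linarith
  set ρ : ℝ := ε / B with hρ
  have hρ0 : 0 < ρ := div_pos hε hB0
  have hρB : ρ * ∑ l, ‖(X l).1‖ < ε := by
    have : ρ * B = ε := div_mul_cancel₀ _ hB0.ne'
    rw [hB, mul_add] at this
    linarith
  have hXle : ∀ l, ‖(X l).1‖ ≤ ∑ l, ‖(X l).1‖ := fun l =>
    Finset.single_le_sum (f := fun l => ‖(X l).1‖) (fun l _ => norm_nonneg _) (Finset.mem_univ l)
  set K : ℝ := ∑ l, ‖g l‖ with hK
  have hgK : ∀ l, ‖g l‖ ≤ K := fun l =>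
    Finset.single_le_sum (f := fun l => ‖g l‖) (fun l _ => norm_nonneg _) (Finset.mem_univ l)
  have hK0 : 0 ≤ K := Finset.sum_nonneg fun l _ => norm_nonneg _
  set a : ι → ℝ := fun l => θ (ρ • (X l).1) / ρ with ha
  refine ⟨-∑ l, a l • g l, ∑ l, a l, min ε (ρ / (2 * K + 1)), by positivity, fun u hu => ?_⟩
  have huε : ‖u‖ < ε := hu.trans_le (min_le_left _ _)
  obtain ⟨⟨i, hi⟩, hmax⟩ := hloc u huε
  have hcone : u ∈ maxCone g i := fun j => hi ▸ hmax j
  set s : ι → ℝ := fun l => inner ℝ (g i) u - inner ℝ (g l) u with hs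
  have hs0 : ∀ l, 0 ≤ s l := fun l => sub_nonneg.2 (hcone l)
  have hsi : s i = 0 := sub_self _
  have hsρ : ∀ l, s l ≤ ρ := by
    intro l
    have h1 : s l ≤ 2 * K * ‖u‖ := by
      have h2 := (abs_le.1 (abs_real_inner_le_norm (g i) u)).2
      have h3 := (abs_le.1 (abs_real_inner_le_norm (g l) u)).1
      have h4 := mul_le_mul_of_nonneg_right (hgK i) (norm_nonneg u)
      have h5 := mul_le_mul_of_nonneg_right (hgK l) (norm_nonneg u)
      simp only [hs]
      linarith
    have h2 : ‖u‖ * (2 * K + 1) < ρ :=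
      (lt_div_iff₀ (by positivity)).1 (hu.trans_le (min_le_right _ _))
    nlinarith [norm_nonneg u]
  -- In the basis `X` of `E k × ℝ` the coordinates of `(u, -⟨gᵢ, u⟩)` are the `s l`.
  have hrep : u = ∑ l, s l • (X l).1 := by
    have h1 : innerAdd g (u, -inner ℝ (g i) u) = innerAdd g (∑ l, s l • X l) := by
      rw [map_sum]
      simp only [map_smul, hX]
      funext j
      simp [innerAdd_apply, Finset.sum_apply, Pi.single_apply, hs]
      ring
    have h2 := congrArg Prod.fst (hbij.1 h1)
    simpa [Prod.fst_sum] using h2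
  have hy : ∀ l, s l • (X l).1 ∈ maxCone g i := by
    intro l
    rcases eq_or_ne l i with rfl | hli
    · simpa [hsi] using zero_mem_maxCone
    · exact smul_mem_maxCone (hXcone i l hli) (hs0 l)
  have hynorm : ∑ l, ‖s l • (X l).1‖ < ε := by
    refine lt_of_le_of_lt ?_ hρB
    rw [Finset.mul_sum]
    refine Finset.sum_le_sum fun l _ => ?_
    rw [norm_smul, Real.norm_of_nonneg (hs0 l)]
    exact mul_le_mul_of_nonneg_right (hsρ l) (norm_nonneg _)
  have hval : ∀ l, θ (s l • (X l).1) = s l * a l := by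
    intro l
    rcases eq_or_ne l i with rfl | hli
    · simp [hsi, h0]
    · have h1 := smul_of_mem_maxCone hloc hnn hadd
        (smul_mem_maxCone (hXcone i l hli) hρ0.le) (?_ : ‖ρ • (X l).1‖ < ε)
        (div_nonneg (hs0 l) hρ0.le) ((div_le_one hρ0).2 (hsρ l))
      · rw [smul_smul, div_mul_cancel₀ _ hρ0.ne'] at h1
        rw [h1, ha]
        ring
      · rw [norm_smul, Real.norm_of_nonneg hρ0.le]
        exact (mul_le_mul_of_nonneg_left (hXle l) hρ0.le).trans_lt hρB
  have hθ : θ u = ∑ l, s l * a l := by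
    conv_lhs => rw [hrep]
    rw [sum_of_mem_maxCone hloc hadd h0 hy _ hynorm]
    exact Finset.sum_congr rfl fun l _ => hval l
  rw [hθ, hi, inner_neg_left, sum_inner, Finset.sum_mul, neg_add_eq_sub,
    ← Finset.sum_sub_distrib]
  refine Finset.sum_congr rfl fun l _ => ?_
  rw [real_inner_smul_left]
  simp only [hs]
  ring

/-! ### From the origin to the whole space -/

/-- Every point near `v` is reached from `v` by a small step forward and a small step backward in
the cone `maxCone g i`, which has nonempty interior. -/
lemma eventually_exists_maxCone_step [Finite ι] (hsurj : Function.Surjective (innerAdd g)) (i : ι)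
    (hε : 0 < ε) (v : E k) {U : Set (E k)} (hU : IsOpen U) (hv : v ∈ U) :
    ∀ᶠ w in nhds v, ∃ a ∈ maxCone g i, ∃ b ∈ maxCone g i, ‖a‖ < ε ∧ ‖b‖ < ε ∧
      v + a ∈ U ∧ v + a = w + b := by
  classical
  obtain ⟨⟨d, t⟩, hd⟩ := hsurj (Pi.single i (1 : ℝ))
  have hdi : ∀ j, j ≠ i → inner ℝ (g j) d < inner ℝ (g i) d := by
    intro j hj
    have h1 := congrFun hd i
    have h2 := congrFun hd j
    rw [innerAdd_apply] at h1 h2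
    simp only [Pi.single_eq_same, Pi.single_eq_of_ne hj] at h1 h2
    linarith
  have hdcone : d ∈ maxCone g i := fun j => by
    rcases eq_or_ne j i with rfl | hj
    · exact le_rfl
    · exact (hdi j hj).le
  obtain ⟨τ, ⟨hτε, hτU⟩, hτ0⟩ : ∃ τ : ℝ, (‖τ • d‖ < ε ∧ v + τ • d ∈ U) ∧ 0 < τ := by
    have h1 : ∀ᶠ τ : ℝ in nhds 0, ‖τ • d‖ < ε := by
      have : Continuous fun τ : ℝ => ‖τ • d‖ := by fun_prop
      exact this.tendsto 0 |>.eventually (gt_mem_nhds (by simpa using hε))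
    have h2 : ∀ᶠ τ : ℝ in nhds 0, v + τ • d ∈ U := by
      have : Continuous fun τ : ℝ => v + τ • d := by fun_prop
      exact this.tendsto 0 |>.eventually (hU.mem_nhds (by simpa using hv))
    exact (((h1.and h2).filter_mono nhdsWithin_le_nhds).and
      (self_mem_nhdsWithin : Set.Ioi (0 : ℝ) ∈ nhdsWithin 0 (Set.Ioi 0))).exists
  have h3 : ∀ᶠ w in nhds v, ‖v + τ • d - w‖ < ε := by
    have : Continuous fun w => ‖v + τ • d - w‖ := by fun_prop
    exact this.tendsto v |>.eventually (gt_mem_nhds (by simpa using hτε))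
  have h4 : ∀ᶠ w in nhds v, ∀ j, inner ℝ (g j) (v + τ • d - w) ≤
      inner ℝ (g i) (v + τ • d - w) := by
    refine Filter.eventually_all.2 fun j => ?_
    rcases eq_or_ne j i with rfl | hj
    · exact Filter.Eventually.of_forall fun w => le_rfl
    · have hcj : Continuous fun w => inner ℝ (g j) (v + τ • d - w) := by fun_prop
      have hci : Continuous fun w => inner ℝ (g i) (v + τ • d - w) := by fun_prop
      have hlt : inner ℝ (g j) (v + τ • d - v) < inner ℝ (g i) (v + τ • d - v) := by
        simp only [add_sub_cancel_left, inner_smul_right]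
        exact mul_lt_mul_of_pos_left (hdi j hj) hτ0
      exact ((hcj.tendsto v).eventually_lt (hci.tendsto v) hlt).mono fun w hw => hw.le
  filter_upwards [h3, h4] with w hw1 hw2
  exact ⟨τ • d, smul_mem_maxCone hdcone hτ0.le, v + τ • d - w, hw2, hτε, hw1, hτU, by abel⟩

/-- A continuous function that does not change along small steps within a cell in the directions of
the corresponding cone is constant on each cell, hence constant. -/
lemma HasCells.eq_of_invariant [Finite ι] {M : Set (Set (E k))} (h : HasCells π (Set.range g) M)
    (hsurj : Function.Surjective (innerAdd g)) (hε : 0 < ε) {ψ : E k → ℝ} (hψ : Continuous ψ)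
    (hinv : ∀ P ∈ M, ∀ i, HasGradientOn π P (g i) → ∀ v ∈ P, ∀ u ∈ maxCone g i, ‖u‖ < ε →
      v + u ∈ P → ψ (v + u) = ψ v) (x y : E k) : ψ x = ψ y := by
  have hlocal : ∀ {v : E k}, (∀ᶠ w in nhds v, ψ w = ψ v) →
      HasFDerivAt ψ (0 : E k →L[ℝ] ℝ) v := fun hv =>
    (hasFDerivAt_const (ψ _) _).congr_of_eventuallyEq hv
  have hint : ∀ P ∈ M, ∀ v ∈ interior P, ∀ w ∈ interior P, ψ v = ψ w := by
    intro P hP v hv w hw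
    obtain ⟨_, ⟨i, rfl⟩, hgrad⟩ := h.gradient P hP
    have hconst : ∀ v ∈ interior P, HasFDerivAt ψ (0 : E k →L[ℝ] ℝ) v := by
      intro v hv
      refine hlocal ?_
      filter_upwards [eventually_exists_maxCone_step hsurj i hε v isOpen_interior hv,
        isOpen_interior.mem_nhds hv] with w hw hwP
      obtain ⟨a, ha, b, hb, haε, hbε, hmem, heq⟩ := hw
      have h1 := hinv P hP i hgrad v (interior_subset hv) a ha haε (interior_subset hmem)
      have h2 := hinv P hP i hgrad w (interior_subset hwP) b hb hbε
        (interior_subset (heq ▸ hmem))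
      rw [← h1, ← h2, heq]
    exact isOpen_interior.is_const_of_fderiv_eq_zero (𝕜 := ℝ)
      ((h.convex P hP).interior.isPreconnected)
      (fun v hv => (hconst v hv).differentiableAt.differentiableWithinAt)
      (fun v hv => (hconst v hv).fderiv) hv hw
  have hcell : ∀ P ∈ M, ∀ v ∈ P, ∀ w ∈ P, ψ v = ψ w := by
    intro P hP v hv w hw
    obtain ⟨p, hp⟩ := h.interior_nonempty P hP
    have hclosed : IsClosed {x | ψ x = ψ p} := isClosed_eq hψ continuous_const
    have hsub : P ⊆ {x | ψ x = ψ p} := by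
      calc P ⊆ closure P := subset_closure
        _ = closure (interior P) := ((h.convex P hP).closure_interior_eq_closure_of_nonempty_interior
            ⟨p, hp⟩).symm
        _ ⊆ {x | ψ x = ψ p} :=
            hclosed.closure_subset_iff.2 fun x hx => hint P hP x hx p hp
    exact (hsub hv).trans (hsub hw).symm
  have hderiv : ∀ r, HasFDerivAt ψ (0 : E k →L[ℝ] ℝ) r := by
    intro r
    obtain ⟨η, hη, hball⟩ := h.exists_ball r
    refine hlocal ?_
    filter_upwards [Metric.ball_mem_nhds r hη] with x hx
    obtain ⟨P, hP, hr, hx⟩ := hball x hx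
    exact hcell P hP x hx r hr
  exact is_const_of_fderiv_eq_zero (𝕜 := ℝ) (fun r => (hderiv r).differentiableAt)
    (fun r => (hderiv r).fderiv) x y

end Rigidity

lemma continuous_of_subadditive {θ : E k → ℝ} (hsub : ∀ u v, θ (u + v) ≤ θ u + θ v)
    (h0 : Filter.Tendsto θ (nhds 0) (nhds 0)) : Continuous θ := by
  rw [continuous_iff_continuousAt]
  intro r
  have h1 : Filter.Tendsto (fun x => x - r) (nhds r) (nhds 0) := by
    have : Continuous fun x : E k => x - r := by fun_prop
    simpa using this.tendsto r
  have h2 : Filter.Tendsto (fun x => r - x) (nhds r) (nhds 0) := by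
    have : Continuous fun x : E k => r - x := by fun_prop
    simpa using this.tendsto r
  have hlow : Filter.Tendsto (fun x => θ r - θ (r - x)) (nhds r) (nhds (θ r)) := by
    simpa using tendsto_const_nhds.sub (h0.comp h2)
  have hup : Filter.Tendsto (fun x => θ r + θ (x - r)) (nhds r) (nhds (θ r)) := by
    simpa using tendsto_const_nhds.add (h0.comp h1)
  refine tendsto_of_tendsto_of_tendsto_of_le_of_le hlow hup (fun x => ?_) fun x => ?_
  · have := hsub x (r - x)
    rw [add_sub_cancel] at this
    linarith
  · have := hsub r (x - r)
    rwa [add_sub_cancel] at this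

/-! ### The slopes and the facet property -/

/-- There are exactly `k + 1` gradients, all of which occur at the origin, where `π` is their
maximum. -/
lemma IsMinimalValid.exists_eq_max_gradients {f : E k} {π : E k → ℝ} (hπ : IsMinimalValid f π)
    {G : Set (E k)} {M : Set (Set (E k))} (hcells : HasCells π G M)
    (hgen : GenuinelyKDimensional π) (hfin : G.Finite) (hcard : G.ncard ≤ k + 1) :
    G.ncard = k + 1 ∧ Function.Bijective (innerAdd fun g : G => (g : E k)) ∧
      ∃ ε : ℝ, 0 < ε ∧ ∀ x, ‖x‖ < ε →
        (∃ g : G, π x = inner ℝ (g : E k) x) ∧ ∀ g : G, inner ℝ (g : E k) x ≤ π x := by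
  have h0 : π 0 = 0 := hπ.eq_zero_of_mem (zero_mem _)
  obtain ⟨G₀, hG₀, ε, hε, hloc⟩ := hcells.exists_eq_max h0 hπ.subadditive
  have hpos : ∀ x, x ≠ 0 → ‖x‖ < ε → 0 < π x := by
    intro x hx hxε
    refine lt_of_le_of_ne (hπ.1.1 x) fun hzero => ?_
    refine not_genuinelyKDimensional_of_segment hπ.1.1 hπ.subadditive
      (fun x z hz => hπ.periodic x hz) (hcells.continuous hfin) hx (fun t ht0 ht1 => ?_) hgen
    have htx : ‖t • x‖ < ε := by
      rw [norm_smul, Real.norm_of_nonneg ht0]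
      exact (mul_le_of_le_one_left (norm_nonneg _) ht1).trans_lt hxε
    obtain ⟨g, hg, hgx⟩ := (hloc _ htx).1
    refine le_antisymm ?_ (hπ.1.1 _)
    rw [hgx, inner_smul_right]
    exact mul_nonpos_of_nonneg_of_nonpos ht0 (((hloc x hxε).2 g hg).trans_eq hzero.symm)
  have hinj : Function.Injective (innerAdd fun g : G₀ => (g : E k)) :=
    innerAdd_injective fun x t h => eq_zero_of_inner_add_eq_zero hε (fun x hx => (hloc x hx).1)
      hpos fun g hg => h ⟨g, hg⟩
  have hfin₀ : G₀.Finite := hfin.subset hG₀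
  have hle : k + 1 ≤ G₀.ncard := by
    have := hfin₀.fintype
    have h1 := LinearMap.finrank_le_finrank_of_injective hinj
    rwa [finrank_prod_real, Module.finrank_fintype_fun_eq_card, ← Nat.card_eq_fintype_card,
      Nat.card_coe_set_eq] at h1
  obtain rfl : G₀ = G := Set.eq_of_subset_of_ncard_le hG₀ (hcard.trans hle) hfin
  have hcard' : G₀.ncard = k + 1 := le_antisymm hcard hle
  refine ⟨hcard', ?_, ε, hε, fun x hx => ⟨?_, fun g => (hloc x hx).2 g g.2⟩⟩
  · have := hfin₀.fintype
    have hrank : Module.finrank ℝ (E k × ℝ) = Module.finrank ℝ (G₀ → ℝ) := by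
      rw [finrank_prod_real, Module.finrank_fintype_fun_eq_card, ← Nat.card_eq_fintype_card,
        Nat.card_coe_set_eq, hcard']
    exact ⟨hinj, (LinearMap.injective_iff_surjective_of_finrank_eq_finrank hrank).1 hinj⟩
  · obtain ⟨g, hg, hgx⟩ := (hloc x hx).1
    exact ⟨⟨g, hg⟩, hgx⟩

/-- A valid function `θ` that is tight wherever `π` is tight has the form `⟨h, ·⟩ + c π`: this holds
near the origin and propagates along the cells. Since `θ` and `π` vanish at the unit vectors and
equal `1` at `-f`, it follows that `h = 0` and `c = 1`. -/
lemma eq_of_tightSolutions_subset {f : E k} {π θ : E k → ℝ} (hπ : IsMinimalValid f π)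
    {ι : Type*} [Fintype ι] {g : ι → E k} {M : Set (Set (E k))}
    (hcells : HasCells π (Set.range g) M) (hbij : Function.Bijective (innerAdd g)) {ε : ℝ}
    (hε : 0 < ε)
    (hloc : ∀ x, ‖x‖ < ε → (∃ i, π x = inner ℝ (g i) x) ∧ ∀ i, inner ℝ (g i) x ≤ π x)
    (hθ : IsValid f θ) (hS : tightSolutions f π ⊆ tightSolutions f θ) : θ = π := by
  have hadd : ∀ u v, π (u + v) = π u + π v → θ (u + v) = θ u + θ v :=
    fun u v => additive_of_tight hπ hS
  have hθ0 : θ 0 = 0 := eq_zero_of_tight hπ hS (zero_mem _)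
  have hπ0 : π 0 = 0 := hπ.eq_zero_of_mem (zero_mem _)
  obtain ⟨h, c, ε', hε', hnear⟩ := exists_eq_inner_add_mul hbij hε hloc hθ.1 hadd hθ0
  have hπc : Continuous π := hcells.continuous (Set.finite_range g)
  have hlin : Continuous fun x => inner ℝ h x + c * π x := by fun_prop
  have hθc : Continuous θ := by
    refine continuous_of_subadditive (subadditive_of_tight hπ hθ hS) ?_
    have h1 : Filter.Tendsto (fun x => inner ℝ h x + c * π x) (nhds 0) (nhds 0) := by
      simpa [hπ0] using hlin.tendsto 0
    refine h1.congr' ?_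
    filter_upwards [Metric.ball_mem_nhds (0 : E k) hε'] with x hx
    exact (hnear x (by simpa using hx)).symm
  have hglobal : ∀ x, θ x = inner ℝ h x + c * π x := by
    intro x
    have hconst := hcells.eq_of_invariant hbij.2 (lt_min hε hε')
      (ψ := fun x => θ x - (inner ℝ h x + c * π x)) (hθc.sub hlin) ?_ x 0
    · simp only [hθ0, hπ0, inner_zero_right, mul_zero, add_zero, sub_zero] at hconst
      linarith
    · intro P hP i hgrad v hv u hu huε hvu
      have h1 : π (v + u) = π v + π u := by
        have h2 := hgrad.sub_eq hvu hv
        rw [add_sub_cancel_left,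
          ← eq_inner_of_mem_maxCone hloc hu (huε.trans_le (min_le_left _ _))] at h2
        linarith
      simp only [hadd v u h1, h1, hnear u (huε.trans_le (min_le_right _ _)), inner_add_right]
      ring
  have hh : h = 0 := by
    ext i
    have hmem : (EuclideanSpace.single i (1 : ℝ) : E k) ∈ intLattice k :=
      ⟨Pi.single i 1, fun j => by
        by_cases hj : j = i
        · subst hj; simp
        · simp [hj]⟩
    have h1 := hglobal (EuclideanSpace.single i 1)
    rw [eq_zero_of_tight hπ hS hmem, hπ.eq_zero_of_mem hmem] at h1
    simpa [EuclideanSpace.inner_single_right] using h1.symm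
  have hc : c = 1 := by
    have h1 := hglobal (-f)
    rw [apply_neg_of_tight hπ hS, hπ.apply_neg, hh] at h1
    simpa using h1.symm
  funext x
  rw [hglobal x, hh, hc]
  simp

end GroupRelaxation

theorem mainTheorem1 (k : ℕ) (f : GroupRelaxation.E k) (π : GroupRelaxation.E k → ℝ)
    (hmin : GroupRelaxation.IsMinimalValid f π)
    (𝒞 : Set (Set (GroupRelaxation.E k)))
    (hpl : GroupRelaxation.IsPiecewiseLinear π 𝒞)
    (hlf : GroupRelaxation.IsLocallyFiniteComplex 𝒞)
    (hgen : GroupRelaxation.GenuinelyKDimensional π)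
    (hslopes : ∃ n : ℕ, n ≤ k + 1 ∧ GroupRelaxation.HasSlopes π 𝒞 n) :
    GroupRelaxation.IsFacet f π ∧ GroupRelaxation.IsExtremeFunction f π ∧
      GroupRelaxation.HasSlopes π 𝒞 (k + 1) := by
  obtain ⟨n, hn, hslopes⟩ := hslopes
  unfold GroupRelaxation.HasSlopes at hslopes ⊢
  have hfin : (GroupRelaxation.gradientSet π 𝒞).Finite :=
    Set.finite_of_encard_eq_coe hslopes
  have hncard : (GroupRelaxation.gradientSet π 𝒞).ncard = n := by
    rw [Set.ncard_def, hslopes, ENat.toNat_natCast]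
  have hcells := hpl.hasCells hlf hfin
  obtain ⟨hcard, hbij, ε, hε, hloc⟩ :=
    hmin.exists_eq_max_gradients hcells hgen hfin (hncard.trans_le hn)
  have := hfin.fintype
  have hfacet : GroupRelaxation.IsFacet f π :=
    ⟨hmin.1, fun θ hθ hS => GroupRelaxation.eq_of_tightSolutions_subset hmin
      (by rwa [Subtype.range_coe]) hbij hε hloc hθ hS⟩
  refine ⟨hfacet, hfacet.isExtremeFunction, ?_⟩
  rw [← hfin.cast_ncard_eq, hcard]
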